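/- Let $1\le k\le\infty$ and let $\mathcal M\subseteq\mathbb R^n$ be an embedded $d$-dimensional submanifold of class $C^k$. Let $H^d$ denote $d$-dimensional Hausdorff measure, scaled to agree with Lebesgue measure on $\mathbb R^d$. Let $P$ be a probability distribution on $\mathbb R^n$ with $P(\mathbb R^n\setminus\mathcal M)=0$ and with density $p:\mathcal M\to[0,\infty)$ with respect to $H^d$, that is, $P(B)=\int_{B\cap\mathcal M}p\,dH^d$ for all Borel sets $B\subseteq\mathbb R^n$. Let $f:\mathbb R^n\to\mathbb R^m$ be a $C^k$ diffeomorphism onto its image, that is, $f$ is injective and of class $C^k$, and its inverse $f(\mathbb R^n)\to\mathbb R^n$ is, near every point of $f(\mathbb R^n)$, the restriction of a $C^k$ map defined on an open subset of $\mathbb R^m$. Let $fP$ be the pushforward of $P$, $fP(S)=P(f^{-1}(S))$. For $x\in\mathcal M$ and a basis $v_1,\dots,v_d$ of the tangent space to $\mathcal M$ at $x$, let $v_i'=\frac{d}{d\varepsilon}f(x+\varepsilon v_i)\big|_{\varepsilon=0}$, and let $V\in\mathbb R^{d\times n}$ and $V'\in\mathbb R^{d\times m}$ be the matrices with rows $v_i$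 and $v_i'$. Then: 1. $f\mathcal M$ is an embedded $d$-dimensional submanifold of $\mathbb R^m$ of class $C^k$, and $fP$ is supported on it: $fP(\mathbb R^m\setminus f\mathcal M)=0$. 2. For every $x\in\mathcal M$ and every basis $v_1,\dots,v_d$ of the tangent space to $\mathcal M$ at $x$, the vectors $v_1',\dots,v_d'$ form a basis of the tangent space to $f\mathcal M$ at $f(x)$. 3. $fP$ has a density $fp:f\mathcal M\to[0,\infty)$ with respect to $H^d$ such that, for every $x\in\mathcal M$ and every such basis, $$fp(f(x))=p(x)\,\frac{\sqrt{\det(VV^T)}}{\sqrt{\det(V'V'^T)}}.$$ Moreover, every density $fp:f\mathcal M\to[0,\infty)$ of $fP$ with respect to $H^d$ satisfies this equation (for all bases) at $H^d$-almost every point $f(x)$ of $f\mathcal M$, and at every point $f(x)$ such that $p$ is continuous at $x$ on $\mathcal M$ and $fp$ is continuous at $f(x)$ on $f\mathcal M$. -/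

import Mathlib

open Set Filter Topology MeasureTheory
open scoped Matrix

noncomputable section

/-- `M ⊆ ℝⁿ` is an (embedded) `d`-dimensional submanifold of class `C^k`: near each of its points it
is the image of a regular local parametrization, i.e. of an immersion of class `C^k` of an open
subset of `ℝᵈ` that is a homeomorphism onto a relatively open subset of `M`. -/
def IsSubmanifold {n : ℕ} (d : ℕ) (k : ℕ∞) (M : Set (EuclideanSpace ℝ (Fin n))) : Prop :=
  ∀ x ∈ M, ∃ (U : Set (EuclideanSpace ℝ (Fin d))) (W : Set (EuclideanSpace ℝ (Fin n)))
    (φ : EuclideanSpace ℝ (Fin d) → EuclideanSpace ℝ (Fin n)),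
    IsOpen U ∧ IsOpen W ∧ x ∈ W ∧ ContDiffOn ℝ k φ U ∧
    (∀ u ∈ U, Function.Injective (fderiv ℝ φ u)) ∧
    IsEmbedding (U.domRestrict φ) ∧ φ '' U = M ∩ W

/-- The tangent space to `M` at `x`: all velocities at time `0` of `C¹` curves in `M` that pass
through `x` at time `0`. -/
def tangentVectors {n : ℕ} (M : Set (EuclideanSpace ℝ (Fin n))) (x : EuclideanSpace ℝ (Fin n)) :
    Set (EuclideanSpace ℝ (Fin n)) :=
  {v | ∃ ε > 0, ∃ γ : ℝ → EuclideanSpace ℝ (Fin n),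
    ContDiffOn ℝ 1 γ (Ioo (-ε) ε) ∧ MapsTo γ (Ioo (-ε) ε) M ∧ γ 0 = x ∧ HasDerivAt γ v 0}

/-- `v₁, …, v_d` is a basis of the tangent space to `M` at `x`. -/
def IsTangentBasis {n d : ℕ} (M : Set (EuclideanSpace ℝ (Fin n))) (x : EuclideanSpace ℝ (Fin n))
    (v : Fin d → EuclideanSpace ℝ (Fin n)) : Prop :=
  LinearIndependent ℝ v ∧
    (Submodule.span ℝ (range v) : Set (EuclideanSpace ℝ (Fin n))) = tangentVectors M x

/-- The `d × n` matrix whose rows are `v₁, …, v_d`. -/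
def rowMatrix {n d : ℕ} (v : Fin d → EuclideanSpace ℝ (Fin n)) : Matrix (Fin d) (Fin n) ℝ :=
  Matrix.of fun i j => v i j

/-- `√(det (V Vᵀ))`, where `V` is the matrix with rows `v₁, …, v_d`. -/
def sqrtDetGram {n d : ℕ} (v : Fin d → EuclideanSpace ℝ (Fin n)) : ℝ :=
  Real.sqrt (rowMatrix v * (rowMatrix v)ᵀ).det

/-- `f : ℝⁿ → ℝᵐ` is a `C^k` diffeomorphism onto its image: it is of class `C^k`, injective, and its
inverse `f(ℝⁿ) → ℝⁿ` is of class `C^k`, in the usual sense for a map on a subset of `ℝᵐ`: near each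
point of `f(ℝⁿ)` it is the restriction of a `C^k` map on an open subset of `ℝᵐ`. -/
structure IsDiffeoOntoImage {n m : ℕ} (k : ℕ∞)
    (f : EuclideanSpace ℝ (Fin n) → EuclideanSpace ℝ (Fin m)) : Prop where
  contDiff : ContDiff ℝ k f
  injective : Function.Injective f
  contDiff_inverse : ∀ x, ∃ (U : Set (EuclideanSpace ℝ (Fin m)))
    (g : EuclideanSpace ℝ (Fin m) → EuclideanSpace ℝ (Fin n)),
    IsOpen U ∧ f x ∈ U ∧ ContDiffOn ℝ k g U ∧ ∀ z, f z ∈ U → g (f z) = z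

/-- `p` (of which only the values on `M` matter) is a density on `M` of the measure `P` with respect
to `d`-dimensional Hausdorff measure. `μHE[d]` is Hausdorff measure scaled so as to agree with
Lebesgue measure in `ℝᵈ`. -/
structure HasHausdorffDensity {n : ℕ} (d : ℕ) (M : Set (EuclideanSpace ℝ (Fin n)))
    (P : Measure (EuclideanSpace ℝ (Fin n))) (p : EuclideanSpace ℝ (Fin n) → ℝ) : Prop where
  aemeasurable : AEMeasurable p (μHE[d].restrict M)
  nonneg : ∀ x ∈ M, 0 ≤ p x
  apply_eq : ∀ B : Set (EuclideanSpace ℝ (Fin n)), MeasurableSet B →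
    P B = ∫⁻ x in B ∩ M, ENNReal.ofReal (p x) ∂μHE[d]

end

open scoped NNReal ENNReal

/-! ### Hausdorff measure of images under nearly linear maps -/

/-! Everything follows from the change of variables formula `H^d(f A) = ∫_A J dH^d` for measurable
`A ⊆ M`, where `J = tangentJacobian f M` is the volume factor of the derivative of `f` on tangent
spaces.

Near a point where a map has injective strict derivative `L`, it distorts distances like `L` up to a
factor close to 1. Hausdorff measure depends only on distances, so the measure of small images is
close to that under `L`, which is `normDet L` times volume. Comparing a chart `φ` with `f ∘ φ`
eliminates the volume and shows that `f` scales `H^d` near `x` by about `J x`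
(`IsSubmanifold.exists_nhds_measure_image`). As `J` is continuous, it can be put under the integral;
a countable cover globalizes the inequalities, and letting the error factor tend to 1 gives equality
(`IsSubmanifold.euclideanHausdorffMeasure_image`).

Hence `H^d` on `f '' M` is the pushforward of `J H^d` on `M`, and `q` is a density of the
pushforward of `P` exactly when `J · (q ∘ f)` is a density of `P`. So `p / J` gives a density, and
any other agrees with it almost everywhere. At points of continuity the agreement is exact, because
relatively open nonempty subsets of `M` have positive measure. Finally, multiplicativity of
`normDet` identifies `1 / J` with the ratio of Gram determinants for every tangent basis. -/

/-- The correspondence `ψ a ↦ φ a` is `c`-Lipschitz on `ψ '' A`. It is well defined even if `ψ` is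
not injective, since `ψ a = ψ b` forces `φ a = φ b`. -/
theorem euclideanHausdorffMeasure_image_le_of_dist_le {X Y Z : Type*} [Nonempty X]
    [MetricSpace Y] [MeasurableSpace Y] [BorelSpace Y]
    [MetricSpace Z] [MeasurableSpace Z] [BorelSpace Z] (d : ℕ) {φ : X → Y} {ψ : X → Z}
    {A : Set X} {c : ℝ≥0} (h : ∀ a ∈ A, ∀ b ∈ A, dist (φ a) (φ b) ≤ c * dist (ψ a) (ψ b)) :
    μHE[d] (φ '' A) ≤ (c : ℝ≥0∞) ^ d * μHE[d] (ψ '' A) := by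
  set g : Z → X := Function.invFunOn ψ A
  have hgA : ∀ z ∈ ψ '' A, g z ∈ A := fun z hz => Function.invFunOn_mem hz
  have hgψ : ∀ z ∈ ψ '' A, ψ (g z) = z := fun z hz => Function.invFunOn_eq hz
  have hlip : LipschitzOnWith c (φ ∘ g) (ψ '' A) := by
    refine LipschitzOnWith.of_dist_le_mul fun y hy z hz => ?_
    have := h _ (hgA y hy) _ (hgA z hz)
    rwa [hgψ y hy, hgψ z hz] at this
  have himg : φ '' A ⊆ (φ ∘ g) '' (ψ '' A) := by
    rintro _ ⟨a, ha, rfl⟩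
    refine ⟨ψ a, mem_image_of_mem ψ ha, ?_⟩
    have hmem := mem_image_of_mem ψ ha
    have := h _ (hgA _ hmem) _ ha
    rw [hgψ _ hmem, dist_self, mul_zero] at this
    exact dist_le_zero.1 this
  have key : μH[d] (φ '' A) ≤ (c : ℝ≥0∞) ^ d * μH[d] (ψ '' A) := by
    refine (measure_mono himg).trans ?_
    simpa using hlip.hausdorffMeasure_image_le (d := (d : ℝ)) (by positivity)
  -- The normalizing constant depends only on `d`, so it is the same in `Y` and `Z`.
  simp only [Measure.euclideanHausdorffMeasure_def, Measure.smul_apply,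
    Measure.nnreal_smul_coe_apply]
  rw [mul_left_comm]
  gcongr

/-- An injective `L` is bounded below, so the linearization error, small relative to `‖a - b‖`, is
also small relative to `‖L a - L b‖`. -/
theorem HasStrictFDerivAt.exists_nhds_dist_le {E F : Type*} [NormedAddCommGroup E]
    [NormedSpace ℝ E] [FiniteDimensional ℝ E] [NormedAddCommGroup F] [NormedSpace ℝ F]
    {φ : E → F} {L : E →L[ℝ] F} {u : E} (h : HasStrictFDerivAt φ L u)
    (hL : Function.Injective L) {c : ℝ} (hc : 1 < c) :
    ∃ N ∈ 𝓝 u, ∀ a ∈ N, ∀ b ∈ N, dist (φ a) (φ b) ≤ c * dist (L a) (L b) ∧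
      dist (L a) (L b) ≤ c * dist (φ a) (φ b) := by
  obtain ⟨K, hK, hKL⟩ := LinearMap.exists_antilipschitzWith L.toLinearMap
    (LinearMap.ker_eq_bot.2 hL)
  have hK' : (0 : ℝ) < K := hK
  -- With this relative error both bounds hold: `1 / (1 - δ) = c` and `1 + δ ≤ c`.
  set δ : ℝ := (c - 1) / c
  have hδ : 0 < δ := div_pos (by linarith) (by linarith)
  have hcδ : c * δ = c - 1 := by simp only [δ]; field_simp
  have hev := h.isLittleO.def (div_pos hδ hK')
  rw [nhds_prod_eq] at hev
  obtain ⟨N, hN, hNN⟩ := mem_prod_self_iff.1 hev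
  refine ⟨N, hN, fun a ha b hb => ?_⟩
  have h1 : ‖φ a - φ b - L (a - b)‖ ≤ δ / K * ‖a - b‖ := hNN (mk_mem_prod ha hb)
  have h2 : ‖a - b‖ ≤ K * ‖L a - L b‖ := by
    simpa [dist_eq_norm] using hKL.le_mul_dist a b
  have h3 : ‖φ a - φ b - (L a - L b)‖ ≤ δ * ‖L a - L b‖ := by
    rw [← map_sub]
    refine h1.trans ?_
    rw [map_sub]
    calc δ / K * ‖a - b‖ ≤ δ / K * (K * ‖L a - L b‖) := by gcongr
      _ = δ * ‖L a - L b‖ := by field_simp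
  have h4 : ‖φ a - φ b‖ ≤ ‖φ a - φ b - (L a - L b)‖ + ‖L a - L b‖ := by
    simpa using norm_add_le (φ a - φ b - (L a - L b)) (L a - L b)
  have h5 : ‖L a - L b‖ ≤ ‖φ a - φ b - (L a - L b)‖ + ‖φ a - φ b‖ := by
    have := norm_sub_le (φ a - φ b) (φ a - φ b - (L a - L b))
    rw [sub_sub_cancel] at this
    linarith
  have h6 := norm_nonneg (L a - L b)
  rw [dist_eq_norm, dist_eq_norm]
  constructor
  · nlinarith
  · have : c * ‖L a - L b‖ ≤ c * (δ * ‖L a - L b‖ + ‖φ a - φ b‖) := by gcongr; linarith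
    nlinarith

/-- Near a point where `φ` is strictly differentiable with injective derivative `L`, the Hausdorff
measure of images under `φ` is nearly `normDet L` times the volume. -/
theorem HasStrictFDerivAt.exists_nhds_euclideanHausdorffMeasure_image {d : ℕ} {F : Type*}
    [NormedAddCommGroup F] [InnerProductSpace ℝ F] [MeasurableSpace F] [BorelSpace F]
    {φ : EuclideanSpace ℝ (Fin d) → F} {L : EuclideanSpace ℝ (Fin d) →L[ℝ] F}
    {u : EuclideanSpace ℝ (Fin d)} (h : HasStrictFDerivAt φ L u)
    (hL : Function.Injective L) {c : ℝ≥0} (hc : 1 < c) :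
    ∃ N ∈ 𝓝 u, ∀ A ⊆ N,
      μHE[d] (φ '' A) ≤ c * (ENNReal.ofReal L.toLinearMap.normDet * volume A) ∧
      ENNReal.ofReal L.toLinearMap.normDet * volume A ≤ c * μHE[d] (φ '' A) := by
  -- A distance factor `b` costs `b ^ d` in `d`-dimensional measure.
  obtain ⟨b, hb, hbc⟩ : ∃ b : ℝ≥0, 1 < b ∧ b ^ d ≤ c := by
    have ht : Tendsto (fun b : ℝ≥0 => b ^ d) (𝓝[>] 1) (𝓝 1) := by
      simpa using ((continuous_pow d).tendsto (1 : ℝ≥0)).mono_left nhdsWithin_le_nhds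
    obtain ⟨b, h1, h2⟩ := ((ht.eventually_le_const hc).and self_mem_nhdsWithin).exists
    exact ⟨b, h2, h1⟩
  have hbc' : (b : ℝ≥0∞) ^ d ≤ c := by exact_mod_cast hbc
  obtain ⟨N, hN, hd⟩ := h.exists_nhds_dist_le hL (c := b) (by exact_mod_cast hb)
  refine ⟨N, hN, fun A hA => ?_⟩
  have hvol : ENNReal.ofReal L.toLinearMap.normDet * volume A = μHE[d] (L '' A) := by
    have := L.toLinearMap.euclideanHausdorffMeasure_image_eq_normDet_mul_volume A
    rw [finrank_euclideanSpace_fin] at this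
    exact this.symm
  rw [hvol]
  constructor
  · refine (euclideanHausdorffMeasure_image_le_of_dist_le d
      (fun a ha b hb => (hd a (hA ha) b (hA hb)).1)).trans ?_
    gcongr
  · refine (euclideanHausdorffMeasure_image_le_of_dist_le d
      (fun a ha b hb => (hd a (hA ha) b (hA hb)).2)).trans ?_
    gcongr

/-! ### Charts and tangent spaces -/

/-- `φ` is a regular `C^k` parametrization, on the open set `U`, of a relatively open part of
`M`. -/
structure IsParametrization {n d : ℕ} (k : ℕ∞) (M : Set (EuclideanSpace ℝ (Fin n)))
    (φ : EuclideanSpace ℝ (Fin d) → EuclideanSpace ℝ (Fin n))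
    (U : Set (EuclideanSpace ℝ (Fin d))) : Prop where
  isOpen : IsOpen U
  contDiffOn : ContDiffOn ℝ k φ U
  injective_fderiv : ∀ u ∈ U, Function.Injective (fderiv ℝ φ u)
  injOn : InjOn φ U
  mapsTo : MapsTo φ U M
  map_nhds : ∀ u ∈ U, map φ (𝓝 u) = 𝓝[M] (φ u)

theorem IsSubmanifold.exists_isParametrization {n d : ℕ} {k : ℕ∞}
    {M : Set (EuclideanSpace ℝ (Fin n))} (hM : IsSubmanifold d k M)
    {x : EuclideanSpace ℝ (Fin n)} (hx : x ∈ M) :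
    ∃ (U : Set (EuclideanSpace ℝ (Fin d)))
      (φ : EuclideanSpace ℝ (Fin d) → EuclideanSpace ℝ (Fin n)),
      IsParametrization k M φ U ∧ ∃ u ∈ U, φ u = x := by
  obtain ⟨U, W, φ, hU, hW, hxW, hφ, hinj, hemb, himg⟩ := hM x hx
  have hxU : x ∈ φ '' U := himg ▸ ⟨hx, hxW⟩
  refine ⟨U, φ, ⟨hU, hφ, hinj, injOn_iff_injective.2 hemb.injective, fun u hu =>
    (himg.subset (mem_image_of_mem φ hu)).1, fun u hu => ?_⟩, hxU⟩
  have h := hemb.map_nhds_eq ⟨u, hu⟩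
  rw [range_domRestrict, himg] at h
  have hφW : φ u ∈ W := (himg.subset (mem_image_of_mem φ hu)).2
  calc map φ (𝓝 u) = map φ (map Subtype.val (𝓝 (⟨u, hu⟩ : U))) := by
        rw [map_nhds_subtype_val, hU.nhdsWithin_eq hu]
    _ = 𝓝[M ∩ W] (φ u) := h
    _ = 𝓝[M] (φ u) := nhdsWithin_inter_of_mem' (nhdsWithin_le_nhds (hW.mem_nhds hφW))

section Parametrization

variable {n d : ℕ} {k : ℕ∞} {M : Set (EuclideanSpace ℝ (Fin n))}
  {φ : EuclideanSpace ℝ (Fin d) → EuclideanSpace ℝ (Fin n)} {U : Set (EuclideanSpace ℝ (Fin d))}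
  {u : EuclideanSpace ℝ (Fin d)}

theorem IsParametrization.hasStrictFDerivAt (h : IsParametrization k M φ U) (hk : 1 ≤ k)
    (hu : u ∈ U) : HasStrictFDerivAt φ (fderiv ℝ φ u) u :=
  (h.contDiffOn.contDiffAt (h.isOpen.mem_nhds hu)).hasStrictFDerivAt
    (fun h0 => by simp_all)

/-- For `⊆`, a curve in `M` has to be lifted differentiably through `φ`. If `Λ` is a linear left
inverse of the derivative, then `Λ ∘ φ` has derivative the identity at `u` and a local inverse `g`.
Near time 0 the curve is `φ ∘ g ∘ Λ ∘ γ`, and the chain rule applies. For `⊇`, images of line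
segments suffice. -/
theorem IsParametrization.tangentVectors_eq (h : IsParametrization k M φ U) (hk : 1 ≤ k)
    (hu : u ∈ U) : tangentVectors M (φ u) = range (fderiv ℝ φ u) := by
  have hφ' := h.hasStrictFDerivAt hk hu
  ext v
  constructor
  · rintro ⟨ε, hε, γ, -, hγM, hγ0, hγ'⟩
    obtain ⟨Λ, hΛ⟩ := (fderiv ℝ φ u).toLinearMap.exists_leftInverse_of_injective
      (LinearMap.ker_eq_bot.2 (h.injective_fderiv u hu))
    have hψ : HasStrictFDerivAt (fun w => Λ.toContinuousLinearMap (φ w))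
        (ContinuousLinearEquiv.refl ℝ (EuclideanSpace ℝ (Fin d)) :
          EuclideanSpace ℝ (Fin d) →L[ℝ] EuclideanSpace ℝ (Fin d)) u := by
      have h1 := Λ.toContinuousLinearMap.hasStrictFDerivAt.comp u hφ'
      refine h1.congr_fderiv ?_
      ext1 w
      exact LinearMap.congr_fun hΛ w
    have hinv := hψ.eventually_left_inverse
    set g := hψ.localInverse
    -- This is where openness of the chart in `M` enters: points of `M` near `φ u` are images of
    -- parameters near `u`, not of other sheets.
    have hγt : Tendsto γ (𝓝 0) (map φ (𝓝 u)) := by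
      rw [h.map_nhds u hu, ← hγ0]
      refine tendsto_nhdsWithin_iff.2 ⟨hγ'.continuousAt, ?_⟩
      filter_upwards [Ioo_mem_nhds (neg_lt_zero.2 hε) hε] with t ht using hγM ht
    have hev : ∀ᶠ y in map φ (𝓝 u), φ (g (Λ.toContinuousLinearMap y)) = y := by
      rw [eventually_map]
      exact hinv.mono fun w hw => congrArg φ hw
    have hg : HasFDerivAt g (ContinuousLinearMap.id ℝ (EuclideanSpace ℝ (Fin d)))
        (Λ.toContinuousLinearMap (γ 0)) := by
      rw [hγ0]
      exact hψ.to_localInverse.hasFDerivAt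
    have hgu : g (Λ.toContinuousLinearMap (γ 0)) = u := by
      rw [hγ0]
      exact hψ.localInverse_apply_image
    have hcomp := (hφ'.hasFDerivAt.comp_hasDerivAt_of_eq (0 : ℝ)
      (hg.comp_hasDerivAt (0 : ℝ) (Λ.toContinuousLinearMap.hasFDerivAt.comp_hasDerivAt (0 : ℝ) hγ'))
      hgu.symm)
    have := (hcomp.congr_of_eventuallyEq ((hγt.eventually hev).mono fun t ht => ht.symm)).unique hγ'
    exact ⟨_, this⟩
  · rintro ⟨w, rfl⟩
    have hcont : Continuous fun t : ℝ => u + t • w := by fun_prop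
    have hmem : (fun t : ℝ => u + t • w) ⁻¹' U ∈ 𝓝 (0 : ℝ) :=
      (h.isOpen.preimage hcont).mem_nhds (by simpa using hu)
    obtain ⟨ε, hε, hball⟩ := Metric.mem_nhds_iff.1 hmem
    rw [Real.ball_eq_Ioo, zero_sub, zero_add] at hball
    refine ⟨ε, hε, fun t => φ (u + t • w), ?_, fun t ht => h.mapsTo (hball ht), by simp, ?_⟩
    · have hcd : ContDiff ℝ 1 fun t : ℝ => u + t • w := by fun_prop
      exact (h.contDiffOn.of_le (by exact_mod_cast hk)).comp hcd.contDiffOn hball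
    · have hd : HasDerivAt (fun t : ℝ => u + t • w) w 0 := by
        simpa using ((hasDerivAt_id (0 : ℝ)).smul_const w).const_add u
      exact hφ'.hasFDerivAt.comp_hasDerivAt_of_eq (0 : ℝ) hd (by simp)

theorem IsParametrization.span_tangentVectors (h : IsParametrization k M φ U) (hk : 1 ≤ k)
    (hu : u ∈ U) :
    Submodule.span ℝ (tangentVectors M (φ u)) = (fderiv ℝ φ u).toLinearMap.range := by
  rw [h.tangentVectors_eq hk hu]
  exact Submodule.span_eq (fderiv ℝ φ u).toLinearMap.range

end Parametrization

/-! ### Diffeomorphisms onto their image -/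

section Diffeo

variable {n m d : ℕ} {k : ℕ∞} {f : EuclideanSpace ℝ (Fin n) → EuclideanSpace ℝ (Fin m)}

/-- A local inverse `g` is continuous at `f x`, so `f z → f x` forces `z = g (f z) → x`. -/
theorem IsDiffeoOntoImage.isEmbedding (hf : IsDiffeoOntoImage k f) : IsEmbedding f := by
  refine ⟨isInducing_iff_nhds.2 fun x => ?_, hf.injective⟩
  refine le_antisymm (hf.contDiff.continuous.tendsto x).le_comap ?_
  obtain ⟨U, g, hU, hxU, hg, hgf⟩ := hf.contDiff_inverse x
  have hg' : Tendsto g (𝓝 (f x)) (𝓝 x) := by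
    have := (hg.continuousOn.continuousAt (hU.mem_nhds hxU)).tendsto
    rwa [hgf x hxU] at this
  have h1 : Tendsto (g ∘ f) (comap f (𝓝 (f x))) (𝓝 x) := hg'.comp tendsto_comap
  refine (h1.congr' ?_ : Tendsto id _ _)
  filter_upwards [preimage_mem_comap (hU.mem_nhds hxU)] with z hz using hgf z hz

theorem IsDiffeoOntoImage.measurableEmbedding (hf : IsDiffeoOntoImage k f) :
    MeasurableEmbedding f :=
  hf.contDiff.continuous.measurableEmbedding hf.injective

theorem IsDiffeoOntoImage.differentiable (hf : IsDiffeoOntoImage k f) (hk : 1 ≤ k) :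
    Differentiable ℝ f :=
  hf.contDiff.differentiable (fun h0 => by simp_all)

theorem IsDiffeoOntoImage.injective_fderiv (hf : IsDiffeoOntoImage k f) (hk : 1 ≤ k)
    (x : EuclideanSpace ℝ (Fin n)) : Function.Injective (fderiv ℝ f x) := by
  obtain ⟨U, g, hU, hxU, hg, hgf⟩ := hf.contDiff_inverse x
  have hg' : DifferentiableAt ℝ g (f x) :=
    (hg.contDiffAt (hU.mem_nhds hxU)).differentiableAt (fun h0 => by simp_all)
  have h1 := hg'.hasFDerivAt.comp x (hf.differentiable hk x).hasFDerivAt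
  have h2 : g ∘ f =ᶠ[𝓝 x] id := by
    filter_upwards [hf.contDiff.continuous.continuousAt.preimage_mem_nhds (hU.mem_nhds hxU)]
      with z hz using hgf z hz
  have h3 := (h1.congr_of_eventuallyEq h2.symm).unique (hasFDerivAt_id x)
  exact Function.LeftInverse.injective (g := fderiv ℝ g (f x)) fun v =>
    DFunLike.congr_fun h3 v

variable {M : Set (EuclideanSpace ℝ (Fin n))}

theorem IsDiffeoOntoImage.fderiv_comp (hf : IsDiffeoOntoImage k f) (hk : 1 ≤ k)
    {φ : EuclideanSpace ℝ (Fin d) → EuclideanSpace ℝ (Fin n)} {u : EuclideanSpace ℝ (Fin d)}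
    (hφ : DifferentiableAt ℝ φ u) :
    fderiv ℝ (f ∘ φ) u = (fderiv ℝ f (φ u)).comp (fderiv ℝ φ u) :=
  _root_.fderiv_comp u (hf.differentiable hk _) hφ

theorem IsParametrization.comp {φ : EuclideanSpace ℝ (Fin d) → EuclideanSpace ℝ (Fin n)}
    {U : Set (EuclideanSpace ℝ (Fin d))} (h : IsParametrization k M φ U)
    (hf : IsDiffeoOntoImage k f) (hk : 1 ≤ k) : IsParametrization k (f '' M) (f ∘ φ) U where
  isOpen := h.isOpen
  contDiffOn := hf.contDiff.comp_contDiffOn h.contDiffOn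
  injective_fderiv u hu := by
    rw [hf.fderiv_comp hk (h.hasStrictFDerivAt hk hu).differentiableAt]
    exact (hf.injective_fderiv hk _).comp (h.injective_fderiv u hu)
  injOn := hf.injective.comp_injOn h.injOn
  mapsTo := (mapsTo_image f M).comp h.mapsTo
  map_nhds u hu := by
    rw [← map_map, h.map_nhds u hu, hf.isEmbedding.map_nhdsWithin_eq]
    rfl

theorem IsSubmanifold.image (hM : IsSubmanifold d k M) (hf : IsDiffeoOntoImage k f)
    (hk : 1 ≤ k) : IsSubmanifold d k (f '' M) := by
  rintro _ ⟨x, hx, rfl⟩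
  obtain ⟨U, W, φ, hU, hW, hxW, hφ, hinj, hemb, himg⟩ := hM x hx
  obtain ⟨W', hW', rfl⟩ := hf.isEmbedding.isOpen_iff.1 hW
  refine ⟨U, W', f ∘ φ, hU, hW', hxW, hf.contDiff.comp_contDiffOn hφ, fun u hu => ?_,
    hf.isEmbedding.comp hemb, ?_⟩
  · have hφu : DifferentiableAt ℝ φ u :=
      (hφ.contDiffAt (hU.mem_nhds hu)).differentiableAt (fun h0 => by simp_all)
    rw [hf.fderiv_comp hk hφu]
    exact (hf.injective_fderiv hk _).comp (hinj u hu)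
  · rw [image_comp, himg, image_inter_preimage]

/-- Both tangent spaces are read off from the charts `φ` and `f ∘ φ`, so no curve needs to be pulled
back through `f`. -/
theorem IsSubmanifold.tangentVectors_image (hM : IsSubmanifold d k M)
    (hf : IsDiffeoOntoImage k f) (hk : 1 ≤ k) {x : EuclideanSpace ℝ (Fin n)} (hx : x ∈ M) :
    tangentVectors (f '' M) (f x) = fderiv ℝ f x '' tangentVectors M x := by
  obtain ⟨U, φ, h, u, hu, rfl⟩ := hM.exists_isParametrization hx
  rw [h.tangentVectors_eq hk hu, ← range_comp]
  refine ((h.comp hf hk).tangentVectors_eq hk hu).trans ?_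
  rw [hf.fderiv_comp hk (h.hasStrictFDerivAt hk hu).differentiableAt]
  rfl

theorem IsTangentBasis.map (hM : IsSubmanifold d k M) (hf : IsDiffeoOntoImage k f) (hk : 1 ≤ k)
    {x : EuclideanSpace ℝ (Fin n)} (hx : x ∈ M) {v : Fin d → EuclideanSpace ℝ (Fin n)}
    (hv : IsTangentBasis M x v) :
    IsTangentBasis (f '' M) (f x) (fun i => fderiv ℝ f x (v i)) := by
  refine ⟨hv.1.map' (fderiv ℝ f x).toLinearMap
    (LinearMap.ker_eq_bot.2 (hf.injective_fderiv hk x)), ?_⟩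
  rw [hM.tangentVectors_image hf hk hx, ← hv.2]
  have : range (fun i => fderiv ℝ f x (v i)) = (fderiv ℝ f x).toLinearMap '' range v := by
    rw [← range_comp]; rfl
  rw [this, Submodule.span_image]
  rfl

end Diffeo

/-! ### Gram determinants and the tangential Jacobian -/

theorem rowMatrix_mul_transpose {n d : ℕ} (v : Fin d → EuclideanSpace ℝ (Fin n)) :
    rowMatrix v * (rowMatrix v)ᵀ = Matrix.gram ℝ v := by
  ext i j
  simp [rowMatrix, Matrix.mul_apply, PiLp.inner_apply, mul_comm]

/-- This links the coordinate-free volume factor to the matrices of the main theorem, and makes its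
continuity in `L` visible. -/
theorem LinearMap.normDet_eq_sqrtDetGram {n d : ℕ}
    (L : EuclideanSpace ℝ (Fin d) →ₗ[ℝ] EuclideanSpace ℝ (Fin n)) :
    L.normDet = sqrtDetGram fun i => L (EuclideanSpace.basisFun (Fin d) ℝ i) := by
  rw [sqrtDetGram, rowMatrix_mul_transpose,
    ← L.normDet_sq_eq_det_gram (EuclideanSpace.basisFun (Fin d) ℝ)]
  exact (Real.sqrt_sq L.normDet_nonneg).symm

theorem continuous_sqrtDetGram {n d : ℕ} :
    Continuous (sqrtDetGram : (Fin d → EuclideanSpace ℝ (Fin n)) → ℝ) := by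
  unfold sqrtDetGram rowMatrix
  refine Real.continuous_sqrt.comp (Continuous.matrix_det ?_)
  refine Continuous.matrix_mul ?_ (Continuous.matrix_transpose ?_) <;>
  exact continuous_matrix fun i j => by simp only [Matrix.of_apply]; fun_prop

theorem continuous_normDet {n d : ℕ} :
    Continuous fun L : EuclideanSpace ℝ (Fin d) →L[ℝ] EuclideanSpace ℝ (Fin n) =>
      L.toLinearMap.normDet := by
  simp_rw [LinearMap.normDet_eq_sqrtDetGram]
  refine continuous_sqrtDetGram.comp (continuous_pi fun i => ?_)
  exact (ContinuousLinearMap.apply ℝ (EuclideanSpace ℝ (Fin n))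
    (EuclideanSpace.basisFun (Fin d) ℝ i)).continuous

theorem LinearMap.normDet_pos_of_injective {E F : Type*} [NormedAddCommGroup E]
    [InnerProductSpace ℝ E] [FiniteDimensional ℝ E] [NormedAddCommGroup F] [InnerProductSpace ℝ F]
    {L : E →ₗ[ℝ] F} (hL : Function.Injective L) : 0 < L.normDet :=
  L.normDet_nonneg.lt_of_ne' ((L.normDet_ne_zero_tfae.out 0 4).2 hL)

/-- The factor by which `f` scales `d`-dimensional volume in the tangent space to `M` at `x`. -/
noncomputable def tangentJacobian {n m : ℕ}
    (f : EuclideanSpace ℝ (Fin n) → EuclideanSpace ℝ (Fin m)) (M : Set (EuclideanSpace ℝ (Fin n)))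
    (x : EuclideanSpace ℝ (Fin n)) : ℝ :=
  ((fderiv ℝ f x).toLinearMap.domRestrict (Submodule.span ℝ (tangentVectors M x))).normDet

section Jacobian

variable {n m d : ℕ} {k : ℕ∞} {f : EuclideanSpace ℝ (Fin n) → EuclideanSpace ℝ (Fin m)}
  {M : Set (EuclideanSpace ℝ (Fin n))} {x : EuclideanSpace ℝ (Fin n)}

theorem tangentJacobian_pos (hf : IsDiffeoOntoImage k f) (hk : 1 ≤ k) :
    0 < tangentJacobian f M x :=
  LinearMap.normDet_pos_of_injective
    ((hf.injective_fderiv hk x).comp Subtype.val_injective)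

theorem normDet_comp_eq_tangentJacobian_mul
    {L : EuclideanSpace ℝ (Fin d) →ₗ[ℝ] EuclideanSpace ℝ (Fin n)}
    (hL : Submodule.span ℝ (tangentVectors M x) = L.range) :
    ((fderiv ℝ f x).toLinearMap ∘ₗ L).normDet = tangentJacobian f M x * L.normDet := by
  -- The domain type of the restricted map depends on the submodule, so the equality is substituted
  -- for a variable submodule.
  have hcongr : ∀ {p q : Submodule ℝ (EuclideanSpace ℝ (Fin n))}, p = q →
      ((fderiv ℝ f x).toLinearMap.domRestrict p).normDet =
        ((fderiv ℝ f x).toLinearMap.domRestrict q).normDet := by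
    rintro p _ rfl
    rfl
  rw [LinearMap.normDet_comp, tangentJacobian, hcongr hL]

theorem IsTangentBasis.sqrtDetGram_pos {v : Fin d → EuclideanSpace ℝ (Fin n)}
    (hv : IsTangentBasis M x v) : 0 < sqrtDetGram v := by
  rw [sqrtDetGram, rowMatrix_mul_transpose]
  exact Real.sqrt_pos.2 (Matrix.posDef_gram_of_linearIndependent hv.1).det_pos

/-- Let `L` send the standard basis to `v`. The two Gram roots are the `normDet` of `L` and of its
composite with the derivative of `f`, and `normDet` is multiplicative. -/
theorem IsTangentBasis.sqrtDetGram_fderiv {v : Fin d → EuclideanSpace ℝ (Fin n)}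
    (hv : IsTangentBasis M x v) :
    sqrtDetGram (fun i => fderiv ℝ f x (v i)) = tangentJacobian f M x * sqrtDetGram v := by
  let L := (EuclideanSpace.basisFun (Fin d) ℝ).toBasis.constr ℝ v
  have hL : ∀ i, L (EuclideanSpace.basisFun (Fin d) ℝ i) = v i := fun i => by
    rw [← OrthonormalBasis.coe_toBasis]
    exact (EuclideanSpace.basisFun (Fin d) ℝ).toBasis.constr_basis ℝ v i
  have hspan : Submodule.span ℝ (tangentVectors M x) = L.range := by
    rw [← hv.2, Submodule.span_eq, Module.Basis.constr_range]
  have h := normDet_comp_eq_tangentJacobian_mul (f := f) hspan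
  rw [LinearMap.normDet_eq_sqrtDetGram, LinearMap.normDet_eq_sqrtDetGram] at h
  simp only [LinearMap.comp_apply, hL] at h
  exact h

/-- The ratio of Gram determinants in the transformation formula does not depend on the basis. -/
theorem IsTangentBasis.sqrtDetGram_div (hf : IsDiffeoOntoImage k f) (hk : 1 ≤ k)
    {v : Fin d → EuclideanSpace ℝ (Fin n)} (hv : IsTangentBasis M x v) :
    sqrtDetGram v / sqrtDetGram (fun i => lineDeriv ℝ f x (v i)) =
      (tangentJacobian f M x)⁻¹ := by
  have hline : (fun i => lineDeriv ℝ f x (v i)) = fun i => fderiv ℝ f x (v i) :=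
    funext fun i => (hf.differentiable hk x).lineDeriv_eq_fderiv
  have h1 := hv.sqrtDetGram_pos.ne'
  have h2 := (tangentJacobian_pos (M := M) (x := x) hf hk).ne'
  rw [hline, hv.sqrtDetGram_fderiv]
  field_simp

variable {φ : EuclideanSpace ℝ (Fin d) → EuclideanSpace ℝ (Fin n)}
  {U : Set (EuclideanSpace ℝ (Fin d))} {u : EuclideanSpace ℝ (Fin d)}

theorem IsParametrization.normDet_fderiv_comp (h : IsParametrization k M φ U)
    (hf : IsDiffeoOntoImage k f) (hk : 1 ≤ k) (hu : u ∈ U) :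
    (fderiv ℝ (f ∘ φ) u).toLinearMap.normDet =
      tangentJacobian f M (φ u) * (fderiv ℝ φ u).toLinearMap.normDet := by
  rw [hf.fderiv_comp hk (h.hasStrictFDerivAt hk hu).differentiableAt]
  exact normDet_comp_eq_tangentJacobian_mul (h.span_tangentVectors hk hu)

theorem IsParametrization.continuousAt_normDet_fderiv (h : IsParametrization k M φ U)
    (hk : 1 ≤ k) (hu : u ∈ U) :
    ContinuousAt (fun w => (fderiv ℝ φ w).toLinearMap.normDet) u :=
  continuous_normDet.continuousAt.comp
    ((h.contDiffOn.continuousOn_fderiv_of_isOpen h.isOpen (by exact_mod_cast hk)).continuousAt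
      (h.isOpen.mem_nhds hu))

/-- In a chart the Jacobian is the quotient of the volume factors of `f ∘ φ` and `φ`, which are
continuous and nonzero. `map_nhds` transfers the limit from the parameter domain to `M`. -/
theorem IsSubmanifold.continuousOn_tangentJacobian (hM : IsSubmanifold d k M)
    (hf : IsDiffeoOntoImage k f) (hk : 1 ≤ k) : ContinuousOn (tangentJacobian f M) M := by
  intro x hx
  obtain ⟨U, φ, h, u, hu, rfl⟩ := hM.exists_isParametrization hx
  have hpos : ∀ w ∈ U, (fderiv ℝ φ w).toLinearMap.normDet ≠ 0 := fun w hw =>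
    (LinearMap.normDet_pos_of_injective (h.injective_fderiv w hw)).ne'
  have hdiv : ∀ w ∈ U, (fderiv ℝ (f ∘ φ) w).toLinearMap.normDet /
      (fderiv ℝ φ w).toLinearMap.normDet = tangentJacobian f M (φ w) := fun w hw => by
    rw [h.normDet_fderiv_comp hf hk hw, mul_div_cancel_right₀ _ (hpos w hw)]
  have hlim := (((h.comp hf hk).continuousAt_normDet_fderiv hk hu).tendsto.div
    (h.continuousAt_normDet_fderiv hk hu).tendsto (hpos u hu))
  rw [hdiv u hu] at hlim
  rw [ContinuousWithinAt, ← h.map_nhds u hu, tendsto_map'_iff]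
  exact hlim.congr' (eventually_of_mem (h.isOpen.mem_nhds hu) hdiv)

/-! ### Hausdorff measure on submanifolds -/

/-- By second countability, countably many chart images cover `M`, and each is an injective
continuous image of an open set, hence Borel. -/
theorem IsSubmanifold.measurableSet (hM : IsSubmanifold d k M) : MeasurableSet M := by
  choose! U φ h u hu hφu using fun x (hx : x ∈ M) => hM.exists_isParametrization hx
  have hnhds : ∀ x ∈ M, φ x '' U x ∈ 𝓝[M] x := fun x hx => by
    have := image_mem_map (m := φ x) ((h x hx).isOpen.mem_nhds (hu x hx))
    rwa [(h x hx).map_nhds _ (hu x hx), hφu x hx] at this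
  obtain ⟨t, htM, htc, hcover⟩ := TopologicalSpace.countable_cover_nhdsWithin hnhds
  have hMeq : M = ⋃ x ∈ t, φ x '' U x :=
    hcover.antisymm (iUnion₂_subset fun x hx => (h x (htM hx)).mapsTo.image_subset)
  rw [hMeq]
  exact MeasurableSet.biUnion htc fun x hx =>
    (h x (htM hx)).isOpen.measurableSet.image_of_continuousOn_injOn
      (h x (htM hx)).contDiffOn.continuousOn (h x (htM hx)).injOn

/-- In a chart, the measure is bounded below by a positive multiple of the volume of a
neighbourhood; the error factor 2 is arbitrary. -/
theorem IsSubmanifold.euclideanHausdorffMeasure_pos (hM : IsSubmanifold d k M) (hk : 1 ≤ k)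
    (hx : x ∈ M) {s : Set (EuclideanSpace ℝ (Fin n))} (hs : s ∈ 𝓝[M] x) : 0 < μHE[d] s := by
  obtain ⟨U, φ, h, u, hu, rfl⟩ := hM.exists_isParametrization hx
  obtain ⟨N, hN, hNA⟩ := (h.hasStrictFDerivAt hk hu).exists_nhds_euclideanHausdorffMeasure_image
    (h.injective_fderiv u hu) one_lt_two
  rw [← h.map_nhds u hu, mem_map] at hs
  have hvol : 0 < volume (N ∩ φ ⁻¹' s) := MeasureTheory.Measure.measure_pos_of_mem_nhds _ (inter_mem hN hs)
  have hJ := ENNReal.ofReal_pos.2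
    (LinearMap.normDet_pos_of_injective (L := (fderiv ℝ φ u).toLinearMap) (h.injective_fderiv u hu))
  have hlt := (ENNReal.mul_pos hJ.ne' hvol.ne').trans_le (hNA _ inter_subset_left).2
  refine (pos_of_mul_pos_right (α := ℝ≥0∞) hlt zero_le).trans_le (measure_mono ?_)
  exact (image_mono inter_subset_right).trans (image_preimage_subset φ s)

/-- Near each point `x` of `M`, `f` scales Hausdorff measure on `M` by about the tangential Jacobian
at `x`. -/
theorem IsSubmanifold.exists_nhds_measure_image (hM : IsSubmanifold d k M)
    (hf : IsDiffeoOntoImage k f) (hk : 1 ≤ k) (hx : x ∈ M) {c : ℝ≥0} (hc : 1 < c) :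
    ∃ W ∈ 𝓝[M] x, ∀ A ⊆ W,
      μHE[d] (f '' A) ≤ c * c * (ENNReal.ofReal (tangentJacobian f M x) * μHE[d] A) ∧
      ENNReal.ofReal (tangentJacobian f M x) * μHE[d] A ≤ c * c * μHE[d] (f '' A) := by
  obtain ⟨U, φ, h, u, hu, rfl⟩ := hM.exists_isParametrization hx
  have hc' := h.comp hf hk
  obtain ⟨N, hN, hNA⟩ := (h.hasStrictFDerivAt hk hu).exists_nhds_euclideanHausdorffMeasure_image
    (h.injective_fderiv u hu) hc
  obtain ⟨N', hN', hNA'⟩ :=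
    (hc'.hasStrictFDerivAt hk hu).exists_nhds_euclideanHausdorffMeasure_image
      (hc'.injective_fderiv u hu) hc
  -- For `A = φ '' B`, both `A` and `f '' A` are compared with the volume of `B`, at the cost of one
  -- factor `c` each.
  refine ⟨φ '' (N ∩ N'), h.map_nhds u hu ▸ image_mem_map (inter_mem hN hN'), fun A hA => ?_⟩
  obtain ⟨B, hB, rfl⟩ := subset_image_iff.1 hA
  obtain ⟨h1, h2⟩ := hNA B (hB.trans inter_subset_left)
  obtain ⟨h3, h4⟩ := hNA' B (hB.trans inter_subset_right)
  rw [h.normDet_fderiv_comp hf hk hu, ENNReal.ofReal_mul (tangentJacobian_pos hf hk).le, image_comp,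
    mul_assoc] at h3 h4
  constructor
  · calc μHE[d] (f '' (φ '' B)) ≤ _ := h3
      _ ≤ c * (ENNReal.ofReal (tangentJacobian f M (φ u)) * (c * μHE[d] (φ '' B))) := by gcongr
      _ = _ := by ring
  · calc ENNReal.ofReal (tangentJacobian f M (φ u)) * μHE[d] (φ '' B)
        ≤ ENNReal.ofReal (tangentJacobian f M (φ u)) *
            (c * (ENNReal.ofReal (fderiv ℝ φ u).toLinearMap.normDet * volume B)) := by gcongr
      _ = c * (ENNReal.ofReal (tangentJacobian f M (φ u)) *
            (ENNReal.ofReal (fderiv ℝ φ u).toLinearMap.normDet * volume B)) := by ring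
      _ ≤ c * (c * μHE[d] (f '' (φ '' B))) := by gcongr
      _ = _ := by ring

end Jacobian

/-- A countable subcover, made disjoint, cuts `A` into pieces on which the local inequality holds;
countable additivity sums them. -/
theorem MeasureTheory.Measure.le_of_locally_le {X : Type*} [TopologicalSpace X]
    [SecondCountableTopology X] [MeasurableSpace X] [OpensMeasurableSpace X] {α β : Measure X}
    {M : Set X} (h : ∀ x ∈ M, ∃ W ∈ 𝓝[M] x, ∀ A ⊆ W, MeasurableSet A → α A ≤ β A)
    {A : Set X} (hA : A ⊆ M) (hAm : MeasurableSet A) : α A ≤ β A := by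
  have h' : ∀ x ∈ M, ∃ O, IsOpen O ∧ x ∈ O ∧ ∀ A ⊆ O ∩ M, MeasurableSet A → α A ≤ β A :=
    fun x hx => by
      obtain ⟨W, hW, hWA⟩ := h x hx
      obtain ⟨O, hO, hxO, hOW⟩ := mem_nhdsWithin.1 hW
      exact ⟨O, hO, hxO, fun A hA => hWA A (hA.trans hOW)⟩
  choose! O hO hxO hOA using h'
  obtain ⟨t, htM, htc, hcover⟩ := TopologicalSpace.countable_cover_nhdsWithin
    fun x hx => nhdsWithin_le_nhds ((hO x hx).mem_nhds (hxO x hx))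
  -- Enumerating the subcover by `ℕ` needs it to be nonempty.
  rcases t.eq_empty_or_nonempty with rfl | hne
  · have : A = ∅ := subset_empty_iff.1 (hA.trans (by simpa using hcover))
    simp [this]
  obtain ⟨e, rfl⟩ := htc.exists_eq_range hne
  have heM : ∀ i, e i ∈ M := fun i => htM (mem_range_self i)
  set s : ℕ → Set X := disjointed fun i => O (e i)
  have hsm : ∀ i, MeasurableSet (s i) :=
    MeasurableSet.disjointed fun i => (hO _ (heM i)).measurableSet
  have hA' : A = ⋃ i, A ∩ s i := by
    rw [← inter_iUnion, iUnion_disjointed, eq_comm, inter_eq_left]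
    simpa using hA.trans hcover
  have hdisj : Pairwise (Function.onFun Disjoint fun i => A ∩ s i) := fun i j hij =>
    (disjoint_disjointed _ hij).mono inter_subset_right inter_subset_right
  rw [hA', measure_iUnion hdisj fun i => hAm.inter (hsm i),
    measure_iUnion hdisj fun i => hAm.inter (hsm i)]
  refine ENNReal.tsum_le_tsum fun i => hOA _ (heM i) _ ?_ (hAm.inter (hsm i))
  exact fun y hy => ⟨disjointed_subset _ i hy.2, hA hy.1⟩

theorem ENNReal.le_of_forall_one_lt_mul {a b : ℝ≥0∞}
    (h : ∀ c : ℝ≥0, 1 < c → a ≤ c * c * c * b) : a ≤ b := by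
  have ht : Tendsto (fun c : ℝ≥0 => ((c * c * c : ℝ≥0) : ℝ≥0∞) * b) (𝓝[>] 1) (𝓝 b) := by
    have h1 : Tendsto (fun c : ℝ≥0 => ((c * c * c : ℝ≥0) : ℝ≥0∞)) (𝓝[>] 1) (𝓝 1) := by
      have : Continuous fun c : ℝ≥0 => ((c * c * c : ℝ≥0) : ℝ≥0∞) := by fun_prop
      simpa using (this.tendsto 1).mono_left nhdsWithin_le_nhds
    simpa using ENNReal.Tendsto.mul_const h1 (Or.inl one_ne_zero)
  refine ge_of_tendsto ht ?_
  filter_upwards [self_mem_nhdsWithin] with c hc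
  simpa using h c hc

/-! ### Change of variables for Hausdorff measure on a submanifold -/

section ChangeOfVariables

variable {n m d : ℕ} {k : ℕ∞} {f : EuclideanSpace ℝ (Fin n) → EuclideanSpace ℝ (Fin m)}
  {M : Set (EuclideanSpace ℝ (Fin n))}

/-- The constant Jacobian at `x` is replaced by the varying one under the integral. By continuity
they agree near `x` up to a factor `c`, which is the third such factor. -/
theorem IsSubmanifold.exists_nhds_withDensity (hM : IsSubmanifold d k M)
    (hf : IsDiffeoOntoImage k f) (hk : 1 ≤ k) {x : EuclideanSpace ℝ (Fin n)} (hx : x ∈ M)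
    {c : ℝ≥0} (hc : 1 < c) :
    ∃ W ∈ 𝓝[M] x, ∀ A ⊆ W, MeasurableSet A →
      μHE[d] (f '' A) ≤ c * c * c * ∫⁻ y in A, ENNReal.ofReal (tangentJacobian f M y) ∂μHE[d] ∧
      ∫⁻ y in A, ENNReal.ofReal (tangentJacobian f M y) ∂μHE[d] ≤ c * c * c * μHE[d] (f '' A) := by
  obtain ⟨W, hW, hWA⟩ := hM.exists_nhds_measure_image hf hk hx hc
  have hpos := tangentJacobian_pos (M := M) (x := x) hf hk
  have hc0 : (0 : ℝ) < c := zero_lt_one.trans (by exact_mod_cast hc)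
  have hc1 : (1 : ℝ) < c := by exact_mod_cast hc
  have hcont := hM.continuousOn_tangentJacobian hf hk x hx
  have h1 : ∀ᶠ y in 𝓝[M] x, tangentJacobian f M y < c * tangentJacobian f M x :=
    hcont.eventually_lt_const (by nlinarith)
  have h2 : ∀ᶠ y in 𝓝[M] x, tangentJacobian f M x < c * tangentJacobian f M y :=
    (hcont.const_mul (c : ℝ)).eventually_const_lt (by nlinarith)
  refine ⟨_, inter_mem hW (h1.and h2), fun A hA hAm => ?_⟩
  obtain ⟨h3, h4⟩ := hWA A (hA.trans inter_subset_left)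
  have hcoe : ∀ r : ℝ, ENNReal.ofReal (c * r) = c * ENNReal.ofReal r := fun r => by
    rw [ENNReal.ofReal_mul hc0.le, ENNReal.ofReal_coe_nnreal]
  constructor
  · calc μHE[d] (f '' A) ≤ _ := h3
      _ = c * c * ∫⁻ _ in A, ENNReal.ofReal (tangentJacobian f M x) ∂μHE[d] := by
        rw [setLIntegral_const]
      _ ≤ c * c * ∫⁻ y in A, c * ENNReal.ofReal (tangentJacobian f M y) ∂μHE[d] := by
        refine mul_le_mul_right ?_ _
        refine setLIntegral_mono' hAm fun y hy => ?_
        rw [← hcoe]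
        exact ENNReal.ofReal_le_ofReal (hA hy).2.2.le
      _ = _ := by rw [lintegral_const_mul' _ _ ENNReal.coe_ne_top]; ring
  · calc ∫⁻ y in A, ENNReal.ofReal (tangentJacobian f M y) ∂μHE[d]
        ≤ ∫⁻ _ in A, c * ENNReal.ofReal (tangentJacobian f M x) ∂μHE[d] := by
          refine setLIntegral_mono' hAm fun y hy => ?_
          rw [← hcoe]
          exact ENNReal.ofReal_le_ofReal (hA hy).2.1.le
      _ = c * (ENNReal.ofReal (tangentJacobian f M x) * μHE[d] A) := by
        rw [setLIntegral_const, mul_assoc]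
      _ ≤ c * (c * c * μHE[d] (f '' A)) := by gcongr
      _ = _ := by ring

/-- The change of variables formula for Hausdorff measure on submanifolds. -/
theorem IsSubmanifold.euclideanHausdorffMeasure_image (hM : IsSubmanifold d k M)
    (hf : IsDiffeoOntoImage k f) (hk : 1 ≤ k) {A : Set (EuclideanSpace ℝ (Fin n))} (hA : A ⊆ M)
    (hAm : MeasurableSet A) :
    μHE[d] (f '' A) = ∫⁻ y in A, ENNReal.ofReal (tangentJacobian f M y) ∂μHE[d] := by
  -- Since `f` is a measurable embedding, `B ↦ μHE[d] (f '' B)` is a measure, so two measures on the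
  -- source space can be compared locally.
  set α : Measure (EuclideanSpace ℝ (Fin n)) := μHE[d].comap f
  set β : Measure (EuclideanSpace ℝ (Fin n)) :=
    μHE[d].withDensity fun y => ENNReal.ofReal (tangentJacobian f M y)
  have hα : ∀ B, α B = μHE[d] (f '' B) := hf.measurableEmbedding.comap_apply _
  have hβ : ∀ B, MeasurableSet B →
      β B = ∫⁻ y in B, ENNReal.ofReal (tangentJacobian f M y) ∂μHE[d] := fun B hB =>
    withDensity_apply _ hB
  rw [← hα, ← hβ A hAm]
  apply le_antisymm
  · refine ENNReal.le_of_forall_one_lt_mul fun c hc => ?_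
    refine Measure.le_of_locally_le (β := (c * c * c : ℝ≥0∞) • β) (M := M) (fun x hx => ?_) hA hAm
    obtain ⟨W, hW, h⟩ := hM.exists_nhds_withDensity hf hk hx hc
    refine ⟨W, hW, fun B hB hBm => ?_⟩
    rw [Measure.smul_apply, smul_eq_mul, hα, hβ B hBm]
    exact (h B hB hBm).1
  · refine ENNReal.le_of_forall_one_lt_mul fun c hc => ?_
    refine Measure.le_of_locally_le (β := (c * c * c : ℝ≥0∞) • α) (M := M) (fun x hx => ?_) hA hAm
    obtain ⟨W, hW, h⟩ := hM.exists_nhds_withDensity hf hk hx hc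
    refine ⟨W, hW, fun B hB hBm => ?_⟩
    rw [Measure.smul_apply, smul_eq_mul, hα, hβ B hBm]
    exact (h B hB hBm).2

theorem IsSubmanifold.restrict_image_eq_map_withDensity (hM : IsSubmanifold d k M)
    (hf : IsDiffeoOntoImage k f) (hk : 1 ≤ k) :
    (μHE[d] : Measure (EuclideanSpace ℝ (Fin m))).restrict (f '' M) =
      ((μHE[d].restrict M).withDensity fun y => ENNReal.ofReal (tangentJacobian f M y)).map f := by
  ext B hB
  have hpre := hf.measurableEmbedding.measurable hB
  rw [hf.measurableEmbedding.map_apply, withDensity_apply _ hpre, Measure.restrict_restrict hpre,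
    Measure.restrict_apply hB,
    ← hM.euclideanHausdorffMeasure_image hf hk inter_subset_right (hpre.inter hM.measurableSet),
    image_preimage_inter]

end ChangeOfVariables

/-! ### Densities -/

theorem MeasurableEmbedding.map_withDensity_comp {X Y : Type*} [MeasurableSpace X]
    [MeasurableSpace Y] {f : X → Y} (hf : MeasurableEmbedding f) (μ : Measure X) (g : Y → ℝ≥0∞) :
    (μ.map f).withDensity g = (μ.withDensity (g ∘ f)).map f := by
  ext B hB
  rw [hf.map_apply, withDensity_apply _ hB, withDensity_apply _ (hf.measurable hB), hf.restrict_map,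
    hf.lintegral_map]
  rfl

section Density

variable {n m d : ℕ} {k : ℕ∞} {M : Set (EuclideanSpace ℝ (Fin n))}
  {P : Measure (EuclideanSpace ℝ (Fin n))} {p : EuclideanSpace ℝ (Fin n) → ℝ}
  {f : EuclideanSpace ℝ (Fin n) → EuclideanSpace ℝ (Fin m)}

theorem forall_apply_eq_iff_eq_withDensity :
    (∀ B : Set (EuclideanSpace ℝ (Fin n)), MeasurableSet B →
      P B = ∫⁻ x in B ∩ M, ENNReal.ofReal (p x) ∂μHE[d]) ↔
      P = (μHE[d].restrict M).withDensity fun x => ENNReal.ofReal (p x) := by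
  rw [Measure.ext_iff]
  refine forall₂_congr fun B hB => ?_
  rw [withDensity_apply _ hB, Measure.restrict_restrict hB]

theorem IsSubmanifold.aemeasurable_tangentJacobian (hM : IsSubmanifold d k M)
    (hf : IsDiffeoOntoImage k f) (hk : 1 ≤ k) :
    AEMeasurable (fun x => ENNReal.ofReal (tangentJacobian f M x)) (μHE[d].restrict M) :=
  ((hM.continuousOn_tangentJacobian hf hk).aemeasurable hM.measurableSet).ennreal_ofReal

/-- Positivity of the Jacobian means that weighting by it creates no new null sets. This is what
lets null sets and a.e. measurability pass between `M` and `f '' M`. -/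
theorem IsSubmanifold.absolutelyContinuous_withDensity_tangentJacobian (hM : IsSubmanifold d k M)
    (hf : IsDiffeoOntoImage k f) (hk : 1 ≤ k) :
    (μHE[d] : Measure (EuclideanSpace ℝ (Fin n))).restrict M ≪
      (μHE[d].restrict M).withDensity fun x => ENNReal.ofReal (tangentJacobian f M x) :=
  withDensity_absolutelyContinuous' (hM.aemeasurable_tangentJacobian hf hk)
    (ae_of_all _ fun _ => (ENNReal.ofReal_pos.2 (tangentJacobian_pos hf hk)).ne')

theorem IsSubmanifold.aemeasurable_restrict_image_iff (hM : IsSubmanifold d k M)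
    (hf : IsDiffeoOntoImage k f) (hk : 1 ≤ k) {q : EuclideanSpace ℝ (Fin m) → ℝ} :
    AEMeasurable q (μHE[d].restrict (f '' M)) ↔ AEMeasurable (q ∘ f) (μHE[d].restrict M) := by
  rw [hM.restrict_image_eq_map_withDensity hf hk, hf.measurableEmbedding.aemeasurable_map_iff]
  exact ⟨fun h => h.mono_ac (hM.absolutelyContinuous_withDensity_tangentJacobian hf hk),
    fun h => h.mono_ac (withDensity_absolutelyContinuous _ _)⟩

theorem IsSubmanifold.ae_restrict_image_iff (hM : IsSubmanifold d k M)
    (hf : IsDiffeoOntoImage k f) (hk : 1 ≤ k) {Q : EuclideanSpace ℝ (Fin m) → Prop} :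
    (∀ᵐ y ∂(μHE[d].restrict (f '' M)), Q y) ↔ ∀ᵐ x ∂(μHE[d].restrict M), Q (f x) := by
  rw [hM.restrict_image_eq_map_withDensity hf hk, hf.measurableEmbedding.ae_map_iff]
  exact ⟨fun h => (hM.absolutelyContinuous_withDensity_tangentJacobian hf hk).ae_le h,
    fun h => (withDensity_absolutelyContinuous _ _).ae_le h⟩

theorem IsSubmanifold.withDensity_restrict_image (hM : IsSubmanifold d k M)
    (hf : IsDiffeoOntoImage k f) (hk : 1 ≤ k) {q : EuclideanSpace ℝ (Fin m) → ℝ}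
    (hq : AEMeasurable (q ∘ f) (μHE[d].restrict M)) :
    ((μHE[d].restrict (f '' M)).withDensity fun y => ENNReal.ofReal (q y)) =
      ((μHE[d].restrict M).withDensity
        fun x => ENNReal.ofReal (tangentJacobian f M x * q (f x))).map f := by
  rw [hM.restrict_image_eq_map_withDensity hf hk, hf.measurableEmbedding.map_withDensity_comp,
    ← withDensity_mul₀ (hM.aemeasurable_tangentJacobian hf hk)
      (show AEMeasurable ((fun y => ENNReal.ofReal (q y)) ∘ f) _ from hq.ennreal_ofReal)]
  congr 2
  funext x
  exact (ENNReal.ofReal_mul (tangentJacobian_pos hf hk).le).symm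

theorem HasHausdorffDensity.exists_map (hM : IsSubmanifold d k M) (hf : IsDiffeoOntoImage k f)
    (hk : 1 ≤ k) (hp : HasHausdorffDensity d M P p) :
    ∃ q : EuclideanSpace ℝ (Fin m) → ℝ, HasHausdorffDensity d (f '' M) (P.map f) q ∧
      ∀ x, q (f x) = p x * (tangentJacobian f M x)⁻¹ := by
  -- The value 0 off the range of `f` is immaterial.
  set q : EuclideanSpace ℝ (Fin m) → ℝ :=
    Function.extend f (fun x => p x * (tangentJacobian f M x)⁻¹) 0
  have hq : ∀ x, q (f x) = p x * (tangentJacobian f M x)⁻¹ := fun x =>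
    hf.injective.extend_apply _ _ x
  have hqm : AEMeasurable (q ∘ f) (μHE[d].restrict M) := by
    have h := hp.aemeasurable.mul
      ((hM.continuousOn_tangentJacobian hf hk).aemeasurable hM.measurableSet).inv
    exact h.congr (ae_of_all _ fun x => (hq x).symm)
  refine ⟨q, ⟨(hM.aemeasurable_restrict_image_iff hf hk).2 hqm, ?_, ?_⟩, hq⟩
  · rintro _ ⟨x, hx, rfl⟩
    rw [hq]
    exact mul_nonneg (hp.nonneg x hx) (inv_nonneg.2 (tangentJacobian_pos hf hk).le)
  · rw [forall_apply_eq_iff_eq_withDensity, hM.withDensity_restrict_image hf hk hqm,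
      forall_apply_eq_iff_eq_withDensity.1 hp.apply_eq]
    congr 2
    funext x
    rw [hq, mul_left_comm, mul_inv_cancel₀ (tangentJacobian_pos hf hk).ne', mul_one]

/-- Pushforward along the embedding `f` can be cancelled, so `p` and `J · (q ∘ f)` are densities of
the same measure `P`. Its finiteness makes densities unique almost everywhere, with no need for
σ-finiteness of Hausdorff measure on `M`. -/
theorem HasHausdorffDensity.ae_eq_map [IsFiniteMeasure P] (hM : IsSubmanifold d k M)
    (hf : IsDiffeoOntoImage k f) (hk : 1 ≤ k) (hp : HasHausdorffDensity d M P p)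
    {q : EuclideanSpace ℝ (Fin m) → ℝ} (hq : HasHausdorffDensity d (f '' M) (P.map f) q) :
    ∀ᵐ x ∂(μHE[d].restrict M), q (f x) = p x * (tangentJacobian f M x)⁻¹ := by
  have hqm := (hM.aemeasurable_restrict_image_iff hf hk).1 hq.aemeasurable
  have hP := forall_apply_eq_iff_eq_withDensity.1 hp.apply_eq
  have hfP := forall_apply_eq_iff_eq_withDensity.1 hq.apply_eq
  rw [hM.withDensity_restrict_image hf hk hqm] at hfP
  have hPq := congrArg (Measure.comap f) hfP
  rw [hf.measurableEmbedding.comap_map, hf.measurableEmbedding.comap_map, hP] at hPq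
  have hfin : ∫⁻ x, ENNReal.ofReal (p x) ∂(μHE[d].restrict M) ≠ ∞ := by
    rw [← setLIntegral_univ, ← withDensity_apply _ MeasurableSet.univ, ← hP]
    exact measure_ne_top P univ
  have hae := (withDensity_eq_iff hp.aemeasurable.ennreal_ofReal
    (((hM.continuousOn_tangentJacobian hf hk).aemeasurable hM.measurableSet).mul
      hqm).ennreal_ofReal hfin).1 hPq
  filter_upwards [hae, ae_restrict_mem hM.measurableSet] with x hx hxM
  have hpos := tangentJacobian_pos (M := M) (x := x) hf hk
  -- `ENNReal.ofReal` identifies all nonpositive reals, so nonnegativity on `M` and `f '' M` is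
  -- needed here.
  have h := (ENNReal.ofReal_eq_ofReal_iff (hp.nonneg x hxM)
    (mul_nonneg hpos.le (hq.nonneg _ (mem_image_of_mem f hxM)))).1 hx
  rw [h]
  field_simp

theorem IsSubmanifold.frequently_of_ae (hM : IsSubmanifold d k M) (hk : 1 ≤ k)
    {x : EuclideanSpace ℝ (Fin n)} (hx : x ∈ M) {Q : EuclideanSpace ℝ (Fin n) → Prop}
    (h : ∀ᵐ y ∂(μHE[d].restrict M), Q y) : ∃ᶠ y in 𝓝[M] x, Q y := by
  intro hnot
  have hpos := hM.euclideanHausdorffMeasure_pos hk hx (inter_mem hnot self_mem_nhdsWithin)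
  rw [ae_iff, Measure.restrict_apply' hM.measurableSet] at h
  exact hpos.ne' h

/-- Almost everywhere agreement implies agreement at points of `M` arbitrarily close to `x`, and
both sides are continuous along `M` at `x`. -/
theorem HasHausdorffDensity.eq_map_of_continuousWithinAt [IsFiniteMeasure P]
    (hM : IsSubmanifold d k M) (hf : IsDiffeoOntoImage k f) (hk : 1 ≤ k)
    (hp : HasHausdorffDensity d M P p) {q : EuclideanSpace ℝ (Fin m) → ℝ}
    (hq : HasHausdorffDensity d (f '' M) (P.map f) q) {x : EuclideanSpace ℝ (Fin n)} (hx : x ∈ M)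
    (hpx : ContinuousWithinAt p M x) (hqx : ContinuousWithinAt q (f '' M) (f x)) :
    q (f x) = p x * (tangentJacobian f M x)⁻¹ := by
  have h1 : Tendsto (q ∘ f) (𝓝[M] x) (𝓝 (q (f x))) :=
    hqx.comp hf.contDiff.continuous.continuousWithinAt (mapsTo_image f M)
  have h2 := hpx.tendsto.mul ((hM.continuousOn_tangentJacobian hf hk x hx).tendsto.inv₀
    (tangentJacobian_pos hf hk).ne')
  exact tendsto_nhds_unique_of_frequently_eq h1 h2
    (hM.frequently_of_ae hk hx (hp.ae_eq_map hM hf hk hq))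

end Density

/-! ### The transformation formula for densities -/

theorem theorem1 {n m d : ℕ} (k : ℕ∞) (hk : 1 ≤ k)
    (M : Set (EuclideanSpace ℝ (Fin n))) (hM : IsSubmanifold d k M)
    (P : Measure (EuclideanSpace ℝ (Fin n))) [IsProbabilityMeasure P] (hPM : P Mᶜ = 0)
    (p : EuclideanSpace ℝ (Fin n) → ℝ) (hp : HasHausdorffDensity d M P p)
    (f : EuclideanSpace ℝ (Fin n) → EuclideanSpace ℝ (Fin m)) (hf : IsDiffeoOntoImage k f) :
    -- the image is a manifold, and it carries the pushforward
    (IsSubmanifold d k (f '' M) ∧ (P.map f) (f '' M)ᶜ = 0) ∧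
    -- directional derivatives along a tangent basis form a tangent basis of the image
    (∀ x ∈ M, ∀ v : Fin d → EuclideanSpace ℝ (Fin n), IsTangentBasis M x v →
      IsTangentBasis (f '' M) (f x) (fun i => lineDeriv ℝ f x (v i))) ∧
    -- the formula, at all points, defines a density of the pushforward
    (∃ fp : EuclideanSpace ℝ (Fin m) → ℝ, HasHausdorffDensity d (f '' M) (P.map f) fp ∧
      ∀ x ∈ M, ∀ v : Fin d → EuclideanSpace ℝ (Fin n), IsTangentBasis M x v →
        fp (f x) = p x * (sqrtDetGram v / sqrtDetGram (fun i => lineDeriv ℝ f x (v i)))) ∧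
    -- every density of the pushforward satisfies the formula almost everywhere, and exactly at
    -- the points where the densities are continuous
    (∀ q : EuclideanSpace ℝ (Fin m) → ℝ, HasHausdorffDensity d (f '' M) (P.map f) q →
      (∀ᵐ y ∂(μHE[d].restrict (f '' M)), ∀ x ∈ M, f x = y →
        ∀ v : Fin d → EuclideanSpace ℝ (Fin n), IsTangentBasis M x v →
          q y = p x * (sqrtDetGram v / sqrtDetGram (fun i => lineDeriv ℝ f x (v i)))) ∧
      (∀ x ∈ M, ContinuousWithinAt p M x → ContinuousWithinAt q (f '' M) (f x) →
        ∀ v : Fin d → EuclideanSpace ℝ (Fin n), IsTangentBasis M x v →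
          q (f x) = p x * (sqrtDetGram v / sqrtDetGram (fun i => lineDeriv ℝ f x (v i))))) := by
  have hfderiv : ∀ (x : EuclideanSpace ℝ (Fin n)) (v : Fin d → EuclideanSpace ℝ (Fin n)),
      (fun i => lineDeriv ℝ f x (v i)) = fun i => fderiv ℝ f x (v i) := fun x v =>
    funext fun i => (hf.differentiable hk x).lineDeriv_eq_fderiv
  refine ⟨⟨hM.image hf hk, ?_⟩, fun x hx v hv => ?_, ?_, fun q hq => ⟨?_, ?_⟩⟩
  · rw [hf.measurableEmbedding.map_apply, preimage_compl, preimage_image_eq M hf.injective, hPM]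
  · rw [hfderiv]
    exact hv.map hM hf hk hx
  · obtain ⟨fp, hfp, hfpf⟩ := hp.exists_map hM hf hk
    exact ⟨fp, hfp, fun x _ v hv => by rw [hv.sqrtDetGram_div hf hk, hfpf]⟩
  · rw [hM.ae_restrict_image_iff hf hk]
    filter_upwards [hp.ae_eq_map hM hf hk hq] with x hx y _ hyx v hv
    obtain rfl := hf.injective hyx
    rw [hv.sqrtDetGram_div hf hk, hx]
  · intro x hx hpx hqx v hv
    rw [hv.sqrtDetGram_div hf hk]
    exact hp.eq_map_of_continuousWithinAt hM hf hk hq hx hpx hqx
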